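/- Let $\sigma$ be a positive Borel measure on $\mathbb R$ with $\int_{\mathbb R}(u^2+1)^{-N}\,d\sigma(u)<\infty$ for some $N\in\mathbb N_0$. Let $\mathcal H=\mathbf L_2(d\sigma)$ be the real Hilbert space of real-valued square-integrable functions, let $\mathcal H_{\mathbb C}$ be its complexification (the complex-valued square-integrable functions), and let $$\Gamma_\sigma=\bigoplus_{n=0}^\infty \mathcal H_{\mathbb C}^{\otimes n},\qquad \mathcal H_{\mathbb C}^{\otimes 0}=\mathbb C\Omega,\quad \|\Omega\|=1,$$ be the full Fock space (Hilbert space tensor products and direct sum). For $h\in\mathcal H$ let $\ell_h f=h\otimes f$ $(f\in\Gamma_\sigma)$ and $T_h=\ell_h+\ell_h^*$. Let $\mathcal M=\{T_h:h\in\mathcal H\}''$ be the von Neumann algebra generated by the operators $T_h$, $h\in\mathcal H$, let $\tau(x)=\langle\Omega,x\Omega\rangle$ for $x\in\mathcal M$, and let $\mathbf L_2(\tau)$ be the Hilbert space completion of $\mathcal M$ with respect to $\langle x,y\rangle_\tau=\tau(x^*y)$. Let $U_n$ be the Chebyshev polynomials of the second kind, $U_n(\cos\theta)=\sin((n+1)\theta)/\sin\theta$.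 Theorem. Let $(h_i)_{i\in I}$ be any orthonormal basis of the real Hilbert space $\mathbf L_2(d\sigma)$ (so one may take $I=\mathbb N_0$ when $\mathbf L_2(d\sigma)$ is infinite-dimensional). Then the elements $$U_\alpha=U_{\alpha_1}\!\left(\tfrac12T_{h_{i_1}}\right)U_{\alpha_2}\!\left(\tfrac12T_{h_{i_2}}\right)\cdots U_{\alpha_k}\!\left(\tfrac12T_{h_{i_k}}\right)\in\mathcal M,$$ where $\alpha=z_{i_1}^{\alpha_1}z_{i_2}^{\alpha_2}\cdots z_{i_k}^{\alpha_k}$ runs over the free monoid generated by letters $z_i$ $(i\in I)$, each element being written in reduced form ($k\ge 0$, $\alpha_j\ge 1$, $i_j\ne i_{j+1}$; for $k=0$, $U_\alpha=1$), form an orthonormal basis of $\mathbf L_2(\tau)$, indexed by $\alpha$. -/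

import Mathlib

open MeasureTheory UniformSpace
open scoped TensorProduct ENNReal

noncomputable section

namespace FreeFock

/-! ### The full Fock space of a complex Hilbert space -/

/-- A complex Hilbert space, bundled (used only to define tensor powers by recursion). -/
structure HilbertC where
  carrier : Type
  [normed : NormedAddCommGroup carrier]
  [inner : InnerProductSpace ℂ carrier]
  [complete : CompleteSpace carrier]

attribute [instance] HilbertC.normed HilbertC.inner HilbertC.complete

section Fock

variable (K : Type) [NormedAddCommGroup K] [InnerProductSpace ℂ K]

/-- The tensor powers `K^{⊗ n}` as Hilbert spaces: `K^{⊗ 0} = ℂ`, and `K^{⊗ (n+1)}` is the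
completed Hilbert space tensor product of `K` with `K^{⊗ n}`. -/
def tensorPowC : ℕ → HilbertC
  | 0 => ⟨ℂ⟩
  | n + 1 => ⟨Completion (K ⊗[ℂ] (tensorPowC n).carrier)⟩

/-- The underlying type of the `n`-th Hilbert space tensor power `K^{⊗ n}`. -/
abbrev TensorPow (n : ℕ) : Type := (tensorPowC K n).carrier

/-- The full Fock space `Γ(K) = ⨁_{n ≥ 0} K^{⊗ n}` (Hilbert space direct sum). -/
abbrev Fock : Type := lp (fun n : ℕ => TensorPow K n) 2

variable {K}

/-- The operator `f ↦ k ⊗ f` from `K^{⊗ n}` to `K^{⊗ (n+1)}`. -/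
def tensorLeft (k : K) (n : ℕ) : TensorPow K n →L[ℂ] TensorPow K (n + 1) :=
  (Completion.toComplL : (K ⊗[ℂ] TensorPow K n) →L[ℂ] Completion (K ⊗[ℂ] TensorPow K n)) ∘L
    (TensorProduct.mkL ℂ K (TensorPow K n) k)

theorem norm_tensorLeft (k : K) (n : ℕ) (x : TensorPow K n) :
    ‖tensorLeft k n x‖ = ‖k‖ * ‖x‖ := by
  change ‖((k ⊗ₜ[ℂ] x : K ⊗[ℂ] TensorPow K n) : Completion (K ⊗[ℂ] TensorPow K n))‖ = _
  rw [Completion.norm_coe, TensorProduct.norm_tmul]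

/-- The components of `ℓ_k f`: zero in degree `0`, and `k ⊗ f_n` in degree `n + 1`. -/
def creationSeq (k : K) (f : ∀ n : ℕ, TensorPow K n) : ∀ n : ℕ, TensorPow K n
  | 0 => 0
  | n + 1 => tensorLeft k n (f n)

theorem hasSum_creationSeq (k : K) (f : Fock K) :
    HasSum (fun n => ‖creationSeq k f n‖ ^ (2 : ℝ≥0∞).toReal)
      ((‖k‖ * ‖f‖) ^ (2 : ℝ≥0∞).toReal) := by
  have hf := (lp.hasSum_norm (p := 2) (by simp) f).mul_left (‖k‖ ^ (2 : ℝ≥0∞).toReal)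
  rw [Real.mul_rpow (norm_nonneg _) (norm_nonneg _)]
  refine (hasSum_nat_add_iff' 1).mp ?_
  simpa [creationSeq, norm_tensorLeft, mul_pow] using hf

/-- The (left) creation operator `ℓ_k f = k ⊗ f` on the full Fock space. -/
def creation (k : K) : Fock K →L[ℂ] Fock K :=
  LinearMap.mkContinuous
    { toFun := fun f => ⟨creationSeq k f,
        memℓp_gen (hasSum_creationSeq k f).summable⟩
      map_add' := fun f g => by
        ext n
        cases n with
        | zero => exact (add_zero 0).symm
        | succ n => exact map_add (tensorLeft k n) (f n) (g n)
      map_smul' := fun c f => by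
        ext n
        cases n with
        | zero => simp [creationSeq]
        | succ n => simp [creationSeq] }
    ‖k‖ fun f => by
      refine lp.norm_le_of_tsum_le (by simp) (by positivity) ?_
      exact (hasSum_creationSeq k f).tsum_eq.le

/-- The field (semicircular) operator `T_k = ℓ_k + ℓ_k^*`. -/
def fieldOp (k : K) : Fock K →L[ℂ] Fock K :=
  creation k + ContinuousLinearMap.adjoint (creation k)

variable (K) in
/-- The unit vector `1` of `K^{⊗ 0} = ℂ`. -/
def tensorUnit : TensorPow K 0 := (1 : ℂ)

variable (K) in
/-- The vacuum vector `Ω`, i.e. the vector `1` of `K^{⊗ 0} = ℂ` placed in degree `0`. -/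
def vacuum : Fock K := lp.single 2 0 (tensorUnit K)

end Fock

/-! ### Generated von Neumann algebras and the `L₂` space of a vector state -/

section VN

universe u
variable {E : Type u} [NormedAddCommGroup E] [InnerProductSpace ℂ E] [CompleteSpace E]

/-- The von Neumann algebra generated by a set `S` of bounded operators: the double commutant
of `S ∪ S^*`. -/
def generatedVN (S : Set (E →L[ℂ] E)) : VonNeumannAlgebra E where
  toStarSubalgebra :=
    StarSubalgebra.centralizer ℂ (StarSubalgebra.centralizer ℂ S : Set (E →L[ℂ] E))
  centralizer_centralizer' := by
    change Set.centralizer (Set.centralizer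
      (StarSubalgebra.centralizer ℂ (StarSubalgebra.centralizer ℂ S : Set (E →L[ℂ] E)) :
        Set (E →L[ℂ] E))) =
      (StarSubalgebra.centralizer ℂ (StarSubalgebra.centralizer ℂ S : Set (E →L[ℂ] E)) :
        Set (E →L[ℂ] E))
    simp

theorem subset_generatedVN (S : Set (E →L[ℂ] E)) {x : E →L[ℂ] E} (hx : x ∈ S) :
    x ∈ (generatedVN S).toStarSubalgebra :=
  StarAlgebra.adjoin_le_centralizer_centralizer ℂ S (StarAlgebra.subset_adjoin ℂ S hx)

/-- The vector functional `x ↦ ⟨ω, x ω⟩` on a von Neumann algebra. -/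
def vectorState (M : VonNeumannAlgebra E) (ω : E) (x : M.toStarSubalgebra) : ℂ :=
  inner ℂ ω ((x : E →L[ℂ] E) ω)

/-- A copy of the von Neumann algebra `M`, to be equipped with the (semi-)inner product
`⟨x, y⟩ = τ(x^* y)`, where `τ` is the vector state of `ω`. -/
@[nolint unusedArguments]
def PreL2 (M : VonNeumannAlgebra E) (_ω : E) : Type u := M.toStarSubalgebra

instance (M : VonNeumannAlgebra E) (ω : E) : AddCommGroup (PreL2 M ω) :=
  inferInstanceAs (AddCommGroup M.toStarSubalgebra)

instance (M : VonNeumannAlgebra E) (ω : E) : Module ℂ (PreL2 M ω) :=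
  inferInstanceAs (Module ℂ M.toStarSubalgebra)

/-- The identity map from `M` to `PreL2 M ω`. -/
def toPreL2 (M : VonNeumannAlgebra E) (ω : E) : M.toStarSubalgebra ≃ₗ[ℂ] PreL2 M ω :=
  LinearEquiv.refl ℂ _

theorem vectorState_star_mul (M : VonNeumannAlgebra E) (ω : E) (x y : M.toStarSubalgebra) :
    vectorState M ω (star x * y) = inner ℂ ((x : E →L[ℂ] E) ω) ((y : E →L[ℂ] E) ω) := by
  simp [vectorState, ContinuousLinearMap.star_eq_adjoint,
    ContinuousLinearMap.adjoint_inner_right]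

/-- The semi-inner product `⟨x, y⟩ = τ(x^* y)` on `M`. -/
abbrev preL2Core (M : VonNeumannAlgebra E) (ω : E) :
    PreInnerProductSpace.Core ℂ (PreL2 M ω) where
  inner x y := vectorState M ω (star ((toPreL2 M ω).symm x) * (toPreL2 M ω).symm y)
  conj_inner_symm x y := by simp only [vectorState_star_mul, inner_conj_symm]
  re_inner_nonneg x := by
    simp only [vectorState_star_mul]
    exact inner_self_nonneg
  add_left x y z := by
    rw [vectorState_star_mul, vectorState_star_mul, vectorState_star_mul, map_add]
    exact inner_add_left _ _ _
  smul_left x y c := by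
    rw [vectorState_star_mul, vectorState_star_mul, map_smul]
    exact inner_smul_left _ _ _

instance (M : VonNeumannAlgebra E) (ω : E) : SeminormedAddCommGroup (PreL2 M ω) :=
  InnerProductSpace.Core.toSeminormedAddCommGroup (c := preL2Core M ω)

instance (M : VonNeumannAlgebra E) (ω : E) : InnerProductSpace ℂ (PreL2 M ω) :=
  InnerProductSpace.ofCore (preL2Core M ω)

/-- The Hilbert space `L₂(τ)`: the (Hausdorff) completion of `M` for `⟨x, y⟩ = τ(x^* y)`, where
`τ` is the vector state of `ω`. -/
abbrev L2 (M : VonNeumannAlgebra E) (ω : E) : Type u := Completion (PreL2 M ω)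

/-- The canonical map `M → L₂(τ)`. -/
def toL2 (M : VonNeumannAlgebra E) (ω : E) (x : M.toStarSubalgebra) : L2 M ω :=
  (toPreL2 M ω x : Completion (PreL2 M ω))

end VN

/-! ### The semicircular system over `L₂(σ)` -/

section Semicircular

variable (σ : Measure ℝ)

/-- The embedding of the real Hilbert space `L₂(σ; ℝ)` into its complexification `L₂(σ; ℂ)`. -/
def complexify : Lp ℝ 2 σ →L[ℝ] Lp ℂ 2 σ := Complex.ofRealCLM.compLpL 2 σ

/-- The full Fock space `Γ_σ` over (the complexification of) the real Hilbert space `L₂(σ)`. -/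
abbrev FockSigma : Type := Fock (Lp ℂ 2 σ)

variable {σ} in
/-- The operator `T_h = ℓ_h + ℓ_h^*` on `Γ_σ`, for `h` in the real Hilbert space `L₂(σ)`. -/
def semicircular (h : Lp ℝ 2 σ) : FockSigma σ →L[ℂ] FockSigma σ := fieldOp (complexify σ h)

/-- The von Neumann algebra `M` generated by the operators `T_h`, `h` in the real Hilbert space
`L₂(σ)`. -/
def freeAlg : VonNeumannAlgebra (FockSigma σ) :=
  generatedVN (Set.range (semicircular (σ := σ)))

/-- `L₂(τ)` for `M` and the vacuum state `τ = ⟨Ω, · Ω⟩`. -/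
abbrev L2tau : Type := L2 (freeAlg σ) (vacuum (Lp ℂ 2 σ))

variable {σ}

/-- `T_h` as an element of `M`. -/
def semicircularElt (h : Lp ℝ 2 σ) : (freeAlg σ).toStarSubalgebra :=
  ⟨semicircular h, subset_generatedVN _ ⟨h, rfl⟩⟩

/-- The reduced words `z_{i_1}^{α_1} ⋯ z_{i_k}^{α_k}` of the free monoid on letters `z_i`,
`i : ι`: lists of pairs `(i_j, α_j)` with `α_j ≥ 1` and `i_j ≠ i_{j+1}`. The empty list is the
unit of the monoid. -/
def ReducedWord (ι : Type*) : Type _ :=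
  {w : List (ι × ℕ+) // w.IsChain (fun a b => a.1 ≠ b.1)}

/-- `U_α = U_{α_1}(½ T_{h_{i_1}}) ⋯ U_{α_k}(½ T_{h_{i_k}})`, an element of `M`; here `U_n` is the
Chebyshev polynomial of the second kind, `U_n(cos θ) = sin((n+1)θ) / sin θ`. -/
def chebyshevWord {ι : Type*} (h : ι → Lp ℝ 2 σ) (α : ReducedWord ι) :
    (freeAlg σ).toStarSubalgebra :=
  (α.1.map fun p => Polynomial.aeval ((1 / 2 : ℂ) • semicircularElt (h p.1))
    (Polynomial.Chebyshev.U ℂ ((p.2 : ℕ) : ℤ))).prod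

end Semicircular

end FreeFock

end

/-!
Since `T_i = ℓ_i + ℓ_i^*` and the `e_i` are orthonormal, `T_i` maps `e_i^{⊗ n} ⊗ v` to
`e_i^{⊗ (n+1)} ⊗ v + e_i^{⊗ (n-1)} ⊗ v` when the elementary tensor `v` does not start with `e_i`
(the second term is absent for `n = 0`). This is the recursion of the polynomials `U_n(x/2)`, so
`U_n(½ T_i) v = e_i^{⊗ n} ⊗ v`, and `U_α Ω` is the elementary tensor spelled out by the reduced
word `α`. The elementary tensors form an orthonormal basis of the Fock space, each is spelled by
exactly one reduced word, and `x ↦ x Ω` extends to an isometry of `L₂(τ)` into the Fock space.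
-/

noncomputable section

namespace FreeFock

section Chebyshev

open Polynomial

variable {𝕜 A : Type*} [Field 𝕜] [Ring A] [Algebra 𝕜 A]

theorem aeval_half_smul_chebyshevU_add_two [NeZero (2 : 𝕜)] (T : A) (m : ℤ) :
    aeval ((1 / 2 : 𝕜) • T) (Chebyshev.U 𝕜 (m + 2)) =
      T * aeval ((1 / 2 : 𝕜) • T) (Chebyshev.U 𝕜 (m + 1)) -
        aeval ((1 / 2 : 𝕜) • T) (Chebyshev.U 𝕜 m) := by
  have two_mul_half : (2 : A) * (1 / 2 : 𝕜) • T = T := by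
    rw [two_mul, ← add_smul, add_halves, one_smul]
  rw [Chebyshev.U_add_two, map_sub, map_mul, map_mul, aeval_X, map_ofNat, two_mul_half]

theorem aeval_half_smul_chebyshevU_smul [NeZero (2 : 𝕜)] {V : Type*} [AddCommGroup V] [Module A V]
    {T : A} {v : ℕ → V} (h₀ : T • v 0 = v 1) (h : ∀ n, T • v (n + 1) = v (n + 2) + v n) (n : ℕ) :
    aeval ((1 / 2 : 𝕜) • T) (Chebyshev.U 𝕜 n) • v 0 = v n := by
  induction n using Nat.twoStepInduction with
  | zero => simp
  | one =>
    have hU : aeval ((1 / 2 : 𝕜) • T) (Chebyshev.U 𝕜 1) = T := by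
      simpa using aeval_half_smul_chebyshevU_add_two (𝕜 := 𝕜) T (-1)
    rw [Nat.cast_one, hU, h₀]
  | more n ih₀ ih₁ =>
    push_cast at ih₁ ⊢
    rw [aeval_half_smul_chebyshevU_add_two, sub_smul, mul_smul, ih₁, ih₀, h, add_sub_cancel_right]

variable {ι : Type*}

variable (𝕜) in
/-- The product `U_{α_1}(½ T_{i_1}) ⋯ U_{α_k}(½ T_{i_k})` along a list of pairs `(i_j, α_j)`, for
elements `T_i` of an arbitrary algebra; `chebyshevWord` is the case `T_i = T_{h_i}`. -/
def chebyshevProd (T : ι → A) (w : List (ι × ℕ+)) : A :=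
  (w.map fun p => aeval ((1 / 2 : 𝕜) • T p.1) (Chebyshev.U 𝕜 ((p.2 : ℕ) : ℤ))).prod

theorem chebyshevProd_cons (T : ι → A) (p : ι × ℕ+) (w : List (ι × ℕ+)) :
    chebyshevProd 𝕜 T (p :: w) =
      aeval ((1 / 2 : 𝕜) • T p.1) (Chebyshev.U 𝕜 (p.2 : ℕ)) * chebyshevProd 𝕜 T w :=
  List.prod_cons

theorem map_chebyshevProd {B : Type*} [Ring B] [Algebra 𝕜 B] (φ : A →ₐ[𝕜] B) (T : ι → A)
    (w : List (ι × ℕ+)) :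
    φ (chebyshevProd 𝕜 T w) = chebyshevProd 𝕜 (fun i => φ (T i)) w := by
  simp [chebyshevProd, map_list_prod, Function.comp_def, ← aeval_algHom_apply]

end Chebyshev

section Words

variable {ι : Type*}

/-- The word `i_1 ⋯ i_1 i_2 ⋯ i_2 ⋯` of length `α_1 + α_2 + ⋯` spelled out by the list of pairs
`(i_j, α_j)`. -/
def spell (w : List (ι × ℕ+)) : List ι :=
  w.flatMap fun p => List.replicate p.2 p.1

theorem spell_cons (p : ι × ℕ+) (w : List (ι × ℕ+)) :
    spell (p :: w) = List.replicate p.2 p.1 ++ spell w :=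
  List.flatMap_cons

theorem head?_spell (w : List (ι × ℕ+)) : (spell w).head? = w.head?.map Prod.fst := by
  cases w with
  | nil => rfl
  | cons p w => simp [spell_cons, List.head?_replicate]

theorem head?_spell_ne_of_isChain_cons {p : ι × ℕ+} {w : List (ι × ℕ+)}
    (h : (p :: w).IsChain (fun a b => a.1 ≠ b.1)) : (spell w).head? ≠ some p.1 := by
  cases w with
  | nil => simp [spell]
  | cons q w => simpa [head?_spell] using h.rel.symm

section RunLengths

variable [DecidableEq ι]

/-- Multiplication of a reduced word by a letter on the left. -/
def pushLetter (i : ι) : List (ι × ℕ+) → List (ι × ℕ+)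
  | [] => [(i, 1)]
  | p :: w => if i = p.1 then (p.1, p.2 + 1) :: w else (i, 1) :: p :: w

/-- Run-length encoding, the inverse of `spell` on reduced words. -/
def runLengths : List ι → List (ι × ℕ+) :=
  List.foldr pushLetter []

theorem isChain_pushLetter (i : ι) {w : List (ι × ℕ+)} (h : w.IsChain (fun a b => a.1 ≠ b.1)) :
    (pushLetter i w).IsChain (fun a b => a.1 ≠ b.1) := by
  cases w with
  | nil => exact List.isChain_singleton _
  | cons p w =>
    by_cases hi : i = p.1
    · cases w <;> simp_all [pushLetter]
    · simp [pushLetter, hi, h]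

theorem pushLetter_of_isChain {i : ι} {n : ℕ+} {w : List (ι × ℕ+)}
    (h : ((i, n) :: w).IsChain (fun a b => a.1 ≠ b.1)) : pushLetter i w = (i, 1) :: w := by
  cases w with
  | nil => rfl
  | cons p w => exact if_neg h.rel

theorem spell_pushLetter (i : ι) (w : List (ι × ℕ+)) : spell (pushLetter i w) = i :: spell w := by
  cases w with
  | nil => rfl
  | cons p w =>
    by_cases hi : i = p.1 <;> simp [pushLetter, spell_cons, hi, List.replicate_succ]

theorem isChain_runLengths (l : List ι) : (runLengths l).IsChain (fun a b => a.1 ≠ b.1) := by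
  induction l with
  | nil => exact List.isChain_nil
  | cons i l ih => exact isChain_pushLetter i ih

theorem spell_runLengths (l : List ι) : spell (runLengths l) = l := by
  induction l with
  | nil => rfl
  | cons i l ih => exact (spell_pushLetter i _).trans (congrArg _ ih)

theorem foldr_pushLetter_replicate {i : ι} {n : ℕ+} {w : List (ι × ℕ+)}
    (h : ((i, n) :: w).IsChain (fun a b => a.1 ≠ b.1)) :
    (List.replicate n i).foldr pushLetter w = (i, n) :: w := by
  have hpush : pushLetter i w = (i, 1) :: w := pushLetter_of_isChain h
  clear h
  induction n with
  | one => exact hpush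
  | succ n ih => simp [List.replicate_succ, ih, pushLetter]

theorem runLengths_spell {w : List (ι × ℕ+)} (h : w.IsChain (fun a b => a.1 ≠ b.1)) :
    runLengths (spell w) = w := by
  induction w with
  | nil => rfl
  | cons p w ih =>
    have hw : (spell w).foldr pushLetter [] = w := ih h.tail
    rw [runLengths, spell_cons, List.foldr_append, hw, foldr_pushLetter_replicate h]

end RunLengths

theorem spell_bijective : Function.Bijective fun α : ReducedWord ι => spell α.1 := by
  classical
  exact Function.bijective_iff_has_inverse.mpr ⟨fun l => ⟨runLengths l, isChain_runLengths l⟩,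
    fun α => Subtype.ext (runLengths_spell α.2), spell_runLengths⟩

end Words

section Fock

variable {K : Type} [NormedAddCommGroup K] [InnerProductSpace ℂ K]

theorem creation_apply_zero (k : K) (f : Fock K) : creation k f 0 = 0 := rfl

theorem creation_apply_succ (k : K) (f : Fock K) (n : ℕ) :
    creation k f (n + 1) = tensorLeft k n (f n) := rfl

theorem inner_tensorLeft (k k' : K) (n : ℕ) (x y : TensorPow K n) :
    inner ℂ (tensorLeft k n x) (tensorLeft k' n y) = inner ℂ k k' * inner ℂ x y :=
  (Completion.inner_coe _ _).trans (TensorProduct.inner_tmul ..)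

theorem inner_creation_creation (k k' : K) (f g : Fock K) :
    inner ℂ (creation k f) (creation k' g) = inner ℂ k k' * inner ℂ f g := by
  have hcreation := lp.hasSum_inner (𝕜 := ℂ) (creation k f) (creation k' g)
  have hfg := (lp.hasSum_inner (𝕜 := ℂ) f g).mul_left (inner ℂ k k')
  refine hcreation.unique ((hasSum_nat_add_iff' 1).mp ?_)
  simpa [creation_apply_zero, creation_apply_succ, inner_tensorLeft] using hfg

theorem inner_tensorUnit_left (x : TensorPow K 0) : inner ℂ (tensorUnit K) x = (x : ℂ) := by
  have inner_one_left (z : ℂ) : inner ℂ (1 : ℂ) z = z := by simp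
  exact inner_one_left x

theorem inner_vacuum_left (f : Fock K) :
    inner ℂ (vacuum K) f = inner ℂ (tensorUnit K) (f 0) :=
  lp.inner_single_left 0 (tensorUnit K) f

theorem inner_vacuum_creation (k : K) (f : Fock K) : inner ℂ (vacuum K) (creation k f) = 0 := by
  rw [inner_vacuum_left, creation_apply_zero, inner_zero_right]

theorem norm_vacuum : ‖vacuum K‖ = 1 :=
  (lp.norm_single two_pos 0 _).trans (norm_one (α := ℂ))

theorem creation_single (k : K) (n : ℕ) (x : TensorPow K n) :
    creation k (lp.single 2 n x) = lp.single 2 (n + 1) (tensorLeft k n x) := by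
  ext m
  cases m with
  | zero => simp [creation_apply_zero, lp.single_apply]
  | succ m =>
    rw [creation_apply_succ]
    obtain rfl | hm := eq_or_ne m n
    · simp
    · rw [lp.single_apply_ne _ _ _ hm, lp.single_apply_ne _ _ _ (Nat.succ_ne_succ_iff.mpr hm),
        map_zero]

theorem adjoint_creation_creation (k k' : K) (f : Fock K) :
    ContinuousLinearMap.adjoint (creation k) (creation k' f) = inner ℂ k k' • f := by
  refine ext_inner_left ℂ fun g => ?_
  rw [ContinuousLinearMap.adjoint_inner_right, inner_creation_creation, inner_smul_right]

theorem adjoint_creation_vacuum (k : K) :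
    ContinuousLinearMap.adjoint (creation k) (vacuum K) = 0 := by
  refine ext_inner_right ℂ fun g => ?_
  rw [ContinuousLinearMap.adjoint_inner_left, inner_vacuum_creation, inner_zero_left]

theorem inner_adjoint_creation_apply (k : K) (f : Fock K) (n : ℕ) (x : TensorPow K n) :
    inner ℂ x (ContinuousLinearMap.adjoint (creation k) f n) =
      inner ℂ (tensorLeft k n x) (f (n + 1)) := by
  rw [← lp.inner_single_left, ContinuousLinearMap.adjoint_inner_right, creation_single,
    lp.inner_single_left]

variable {ι : Type*} {e : ι → K}

theorem eq_zero_of_forall_inner_coe_tmul {F G : Type*} [NormedAddCommGroup F]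
    [InnerProductSpace ℂ F] [NormedAddCommGroup G] [InnerProductSpace ℂ G]
    {y : Completion (F ⊗[ℂ] G)}
    (hy : ∀ (k : F) (x : G), inner ℂ ((k ⊗ₜ[ℂ] x : F ⊗[ℂ] G) : Completion (F ⊗[ℂ] G)) y = 0) :
    y = 0 := by
  refine Completion.denseRange_coe.eq_zero_of_inner_left ℂ fun t => ?_
  induction t using TensorProduct.induction_on with
  | zero => rw [Completion.coe_zero, inner_zero_right]
  | tmul k x => exact inner_eq_zero_symm.mp (hy k x)
  | add s t hs ht => rw [Completion.coe_add, inner_add_right, hs, ht, add_zero]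

theorem inner_tensorLeft_eq_zero_of_dense_span
    (he : (Submodule.span ℂ (Set.range e)).topologicalClosure = ⊤) {n : ℕ}
    {x : TensorPow K n} {y : TensorPow K (n + 1)}
    (hy : ∀ i, inner ℂ (tensorLeft (e i) n x) y = 0) (k : K) :
    inner ℂ (tensorLeft k n x) y = 0 := by
  let L : K →L[ℂ] TensorPow K (n + 1) :=
    Completion.toComplL ∘L (TensorProduct.mkL ℂ K (TensorPow K n)).flip x
  have hL : innerSL ℂ y ∘L L = 0 :=
    ContinuousLinearMap.ext_on (Submodule.dense_iff_topologicalClosure_eq_top.mpr he) <| by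
      rintro _ ⟨i, rfl⟩
      exact inner_eq_zero_symm.mp (hy i)
  exact inner_eq_zero_symm.mp (DFunLike.congr_fun hL k)

/-- The elementary tensor `e_{i_1} ⊗ ⋯ ⊗ e_{i_n}` as a vector of the full Fock space. -/
def wordVec (e : ι → K) : List ι → Fock K
  | [] => vacuum K
  | i :: w => creation (e i) (wordVec e w)

theorem orthonormal_wordVec (he : Orthonormal ℂ e) : Orthonormal ℂ (wordVec e) := by
  classical
  refine orthonormal_iff_ite.mpr fun v w => ?_
  induction v generalizing w with
  | nil =>
    cases w with
    | nil => simp [wordVec, inner_self_eq_norm_sq_to_K, norm_vacuum]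
    | cons j w => simp [wordVec, inner_vacuum_creation]
  | cons i v ih =>
    cases w with
    | nil => simp [wordVec, inner_eq_zero_symm.mp (inner_vacuum_creation _ _)]
    | cons j w =>
      rw [wordVec, wordVec, inner_creation_creation, orthonormal_iff_ite.mp he, ih]
      simp [← ite_and, and_comm]

theorem apply_eq_zero_of_forall_inner_wordVec
    (he : (Submodule.span ℂ (Set.range e)).topologicalClosure = ⊤) {f : Fock K}
    (hf : ∀ w, inner ℂ (wordVec e w) f = 0) (n : ℕ) : f n = 0 := by
  induction n generalizing f with
  | zero =>
    rw [← inner_tensorUnit_left (f 0), ← inner_vacuum_left]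
    exact hf []
  | succ n ih =>
    refine eq_zero_of_forall_inner_coe_tmul fun k x =>
      inner_tensorLeft_eq_zero_of_dense_span he (fun i => ?_) k
    have hadj : ContinuousLinearMap.adjoint (creation (e i)) f n = 0 :=
      ih fun w => (ContinuousLinearMap.adjoint_inner_right _ _ _).trans (hf (i :: w))
    rw [← inner_adjoint_creation_apply, hadj, inner_zero_right]

theorem orthogonal_span_wordVec (he : (Submodule.span ℂ (Set.range e)).topologicalClosure = ⊤) :
    (Submodule.span ℂ (Set.range (wordVec e)))ᗮ = ⊥ := by
  refine (Submodule.eq_bot_iff _).mpr fun f hf => ?_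
  ext n
  exact apply_eq_zero_of_forall_inner_wordVec he
    (fun w => hf _ (Submodule.subset_span ⟨w, rfl⟩)) n

theorem adjoint_creation_wordVec (he : Orthonormal ℂ e) {i : ι} {w : List ι}
    (hw : w.head? ≠ some i) :
    ContinuousLinearMap.adjoint (creation (e i)) (wordVec e w) = 0 := by
  cases w with
  | nil => exact adjoint_creation_vacuum _
  | cons j w =>
    have hij : i ≠ j := fun h => hw (congrArg some h.symm)
    rw [wordVec, adjoint_creation_creation, he.2 hij, zero_smul]

theorem fieldOp_wordVec_of_head?_ne (he : Orthonormal ℂ e) {i : ι} {w : List ι}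
    (hw : w.head? ≠ some i) : fieldOp (e i) (wordVec e w) = wordVec e (i :: w) := by
  rw [fieldOp, add_apply, adjoint_creation_wordVec he hw, add_zero, wordVec]

theorem fieldOp_wordVec_cons_self (he : Orthonormal ℂ e) (i : ι) (w : List ι) :
    fieldOp (e i) (wordVec e (i :: w)) = wordVec e (i :: i :: w) + wordVec e w := by
  have hi : inner ℂ (e i) (e i) = (1 : ℂ) := inner_self_eq_one_of_norm_eq_one (he.1 i)
  rw [fieldOp, add_apply, wordVec, adjoint_creation_creation, hi, one_smul, wordVec, wordVec]

theorem aeval_chebyshevU_fieldOp_wordVec (he : Orthonormal ℂ e) {i : ι} {w : List ι}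
    (hw : w.head? ≠ some i) (n : ℕ) :
    Polynomial.aeval ((1 / 2 : ℂ) • fieldOp (e i)) (Polynomial.Chebyshev.U ℂ n) (wordVec e w) =
      wordVec e (List.replicate n i ++ w) :=
  aeval_half_smul_chebyshevU_smul (𝕜 := ℂ) (T := fieldOp (e i))
    (v := fun n => wordVec e (List.replicate n i ++ w))
    (fieldOp_wordVec_of_head?_ne he hw)
    (fun n => fieldOp_wordVec_cons_self he i (List.replicate n i ++ w)) n

theorem chebyshevProd_fieldOp_vacuum (he : Orthonormal ℂ e) {w : List (ι × ℕ+)}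
    (hw : w.IsChain (fun a b => a.1 ≠ b.1)) :
    chebyshevProd ℂ (fun i => fieldOp (e i)) w (vacuum K) = wordVec e (spell w) := by
  induction w with
  | nil => rfl
  | cons p w ih =>
    rw [chebyshevProd_cons, mul_apply_eq_comp, ih hw.tail,
      aeval_chebyshevU_fieldOp_wordVec he (head?_spell_ne_of_isChain_cons hw), spell_cons]

end Fock

section Isometry

variable {𝕜 E F ι : Type*} [RCLike 𝕜] [NormedAddCommGroup E] [InnerProductSpace 𝕜 E]
  [NormedAddCommGroup F] [InnerProductSpace 𝕜 F]

theorem orthogonal_span_range_of_linearIsometry (V : E →ₗᵢ[𝕜] F) {v : ι → E}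
    (hv : (Submodule.span 𝕜 (Set.range (V ∘ v)))ᗮ = ⊥) : (Submodule.span 𝕜 (Set.range v))ᗮ = ⊥ := by
  refine (Submodule.eq_bot_iff _).mpr fun z hz => ?_
  have hVz : V z ∈ (Submodule.span 𝕜 (Set.range (V ∘ v)))ᗮ := by
    rw [Set.range_comp, ← V.coe_toLinearMap, Submodule.span_image]
    rintro _ ⟨u, hu, rfl⟩
    exact (V.inner_map_map u z).trans (hz u hu)
  rw [hv, Submodule.mem_bot] at hVz
  exact (map_eq_zero_iff V V.injective).mp hVz

end Isometry

section GNS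

universe u
variable {E : Type u} [NormedAddCommGroup E] [InnerProductSpace ℂ E] [CompleteSpace E]
  (M : VonNeumannAlgebra E) (ω : E)

theorem norm_toPreL2 (x : M.toStarSubalgebra) : ‖toPreL2 M ω x‖ = ‖(x : E →L[ℂ] E) ω‖ := by
  rw [@norm_eq_sqrt_re_inner ℂ, @norm_eq_sqrt_re_inner ℂ]
  exact congrArg (fun z => √(RCLike.re z)) (vectorState_star_mul M ω x x)

/-- The map `x ↦ x ω`, which is isometric on `M` with the inner product `τ(x^* y)`. -/
def evalPreL2 : PreL2 M ω →ₗᵢ[ℂ] E where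
  toFun x := ((toPreL2 M ω).symm x : E →L[ℂ] E) ω
  map_add' _ _ := rfl
  map_smul' _ _ := rfl
  norm_map' x := (norm_toPreL2 M ω ((toPreL2 M ω).symm x)).symm

/-- The extension of `x ↦ x ω` to an isometry of `L₂(τ)` into the Hilbert space on which `M` acts,
as in the GNS construction. -/
def evalL2 : L2 M ω →ₗᵢ[ℂ] E where
  toLinearMap := ((evalPreL2 M ω).toContinuousLinearMap.extend
    (Completion.toComplL : PreL2 M ω →L[ℂ] L2 M ω)).toLinearMap
  norm_map' x := by
    refine Completion.induction_on x (isClosed_eq (by fun_prop) continuous_norm) fun y => ?_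
    exact (congrArg norm (ContinuousLinearMap.extend_eq _ Completion.denseRange_coe
      (Completion.isUniformInducing_coe _) y)).trans
        (((evalPreL2 M ω).norm_map y).trans (Completion.norm_coe y).symm)

theorem evalL2_toL2 (x : M.toStarSubalgebra) : evalL2 M ω (toL2 M ω x) = (x : E →L[ℂ] E) ω :=
  ContinuousLinearMap.extend_eq _ Completion.denseRange_coe
    (Completion.isUniformInducing_coe _) (toPreL2 M ω x)

end GNS

section Complexification

variable {α ι : Type*} [MeasurableSpace α] {μ : Measure α}

theorem inner_ofReal_compLpL (f g : Lp ℝ 2 μ) :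
    inner ℂ (Complex.ofRealCLM.compLpL 2 μ f) (Complex.ofRealCLM.compLpL 2 μ g) =
      ((inner ℝ f g : ℝ) : ℂ) := by
  rw [L2.inner_def, L2.inner_def, ← integral_complex_ofReal]
  refine integral_congr_ae ?_
  filter_upwards [Complex.ofRealCLM.coeFn_compLpL f, Complex.ofRealCLM.coeFn_compLpL g] with u hf hg
  simp [hf, hg]

theorem ofReal_compLpL_re_add_I_smul_im (F : Lp ℂ 2 μ) :
    Complex.ofRealCLM.compLpL 2 μ (Complex.reCLM.compLpL 2 μ F) +
      Complex.I • Complex.ofRealCLM.compLpL 2 μ (Complex.imCLM.compLpL 2 μ F) = F := by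
  set f := Complex.reCLM.compLpL 2 μ F
  set g := Complex.imCLM.compLpL 2 μ F
  refine Lp.ext ?_
  filter_upwards [Lp.coeFn_add (Complex.ofRealCLM.compLpL 2 μ f)
      (Complex.I • Complex.ofRealCLM.compLpL 2 μ g),
    Lp.coeFn_smul Complex.I (Complex.ofRealCLM.compLpL 2 μ g),
    Complex.ofRealCLM.coeFn_compLpL f, Complex.ofRealCLM.coeFn_compLpL g,
    Complex.reCLM.coeFn_compLpL F, Complex.imCLM.coeFn_compLpL F] with u hadd hsmul hf hg hre him
  rw [hadd, Pi.add_apply, hsmul, Pi.smul_apply, hf, hg, hre, him]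
  simp [mul_comm Complex.I]

theorem orthonormal_ofReal_compLpL {h : ι → Lp ℝ 2 μ} (hh : Orthonormal ℝ h) :
    Orthonormal ℂ fun i => Complex.ofRealCLM.compLpL 2 μ (h i) := by
  classical
  refine orthonormal_iff_ite.mpr fun i j => ?_
  rw [inner_ofReal_compLpL, orthonormal_iff_ite.mp hh]
  split_ifs <;> simp

theorem topologicalClosure_span_ofReal_compLpL {h : ι → Lp ℝ 2 μ}
    (hh : (Submodule.span ℝ (Set.range h)).topologicalClosure = ⊤) :
    (Submodule.span ℂ (Set.range fun i =>
      Complex.ofRealCLM.compLpL 2 μ (h i))).topologicalClosure = ⊤ := by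
  set S := (Submodule.span ℂ (Set.range fun i =>
    Complex.ofRealCLM.compLpL 2 μ (h i))).topologicalClosure
  have hreal (f : Lp ℝ 2 μ) : Complex.ofRealCLM.compLpL 2 μ f ∈ S := by
    have hspan : Submodule.span ℝ (Set.range h) ≤
        (S.restrictScalars ℝ).comap (Complex.ofRealCLM.compLpL 2 μ).toLinearMap := by
      rw [Submodule.span_le]
      rintro _ ⟨i, rfl⟩
      exact Submodule.le_topologicalClosure _ (Submodule.subset_span ⟨i, rfl⟩)
    have hclosed : IsClosed (S : Set (Lp ℂ 2 μ)) := Submodule.isClosed_topologicalClosure _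
    exact Submodule.topologicalClosure_minimal _ hspan
      (hclosed.preimage (Complex.ofRealCLM.compLpL 2 μ).continuous) (hh.ge Submodule.mem_top)
  refine eq_top_iff.mpr fun F _ => ?_
  rw [← ofReal_compLpL_re_add_I_smul_im F]
  exact S.add_mem (hreal _) (S.smul_mem _ (hreal _))

end Complexification

end FreeFock

end

open FreeFock in
theorem theorem4p2_general {K : Type} [NormedAddCommGroup K] [InnerProductSpace ℂ K]
    {ι : Type*} {e : ι → K} (he : Orthonormal ℂ e)
    (hspan : (Submodule.span ℂ (Set.range e)).topologicalClosure = ⊤)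
    {M : VonNeumannAlgebra (Fock K)} {T : ι → M.toStarSubalgebra}
    (hT : ∀ i, (T i : Fock K →L[ℂ] Fock K) = fieldOp (e i)) :
    ∃ b : HilbertBasis (ReducedWord ι) ℂ (L2 M (vacuum K)),
      ∀ α, b α = toL2 M (vacuum K) (chebyshevProd ℂ T α.1) := by
  let v : ReducedWord ι → L2 M (vacuum K) := fun α => toL2 M (vacuum K) (chebyshevProd ℂ T α.1)
  let V : L2 M (vacuum K) →ₗᵢ[ℂ] Fock K := evalL2 M (vacuum K)
  have hVv : V ∘ v = wordVec e ∘ fun α => spell α.1 := by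
    funext α
    have hmap : ((chebyshevProd ℂ T α.1 : M.toStarSubalgebra) : Fock K →L[ℂ] Fock K) =
        chebyshevProd ℂ (fun i => fieldOp (e i)) α.1 := by
      simp only [← hT]
      exact map_chebyshevProd M.toStarSubalgebra.subtype.toAlgHom T α.1
    exact (evalL2_toL2 _ _ _).trans (by rw [hmap, chebyshevProd_fieldOp_vacuum he α.2]; rfl)
  have hv : Orthonormal ℂ v := by
    rw [← V.orthonormal_comp_iff, hVv]
    exact (orthonormal_wordVec he).comp _ spell_bijective.injective
  have hv_total : (Submodule.span ℂ (Set.range v))ᗮ = ⊥ := by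
    refine orthogonal_span_range_of_linearIsometry V ?_
    rw [hVv, spell_bijective.surjective.range_comp]
    exact orthogonal_span_wordVec hspan
  exact ⟨HilbertBasis.mkOfOrthogonalEqBot hv hv_total,
    fun α => congrFun (HilbertBasis.coe_mkOfOrthogonalEqBot hv hv_total) α⟩

theorem theorem4p2 (σ : Measure ℝ)
    (hσ : ∃ N : ℕ, ∫⁻ u : ℝ, ENNReal.ofReal (1 / (u ^ 2 + 1) ^ N) ∂σ < ∞)
    {ι : Type*} (h : HilbertBasis ι ℝ (Lp ℝ 2 σ)) :
    ∃ b : HilbertBasis (FreeFock.ReducedWord ι) ℂ (FreeFock.L2tau σ),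
      ∀ α : FreeFock.ReducedWord ι,
        b α = FreeFock.toL2 (FreeFock.freeAlg σ) (FreeFock.vacuum (Lp ℂ 2 σ))
          (FreeFock.chebyshevWord (fun i => h i) α) :=
  theorem4p2_general (FreeFock.orthonormal_ofReal_compLpL h.orthonormal)
    (FreeFock.topologicalClosure_span_ofReal_compLpL h.dense_span)
    (T := fun i => FreeFock.semicircularElt (h i)) fun _ => rfl
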